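/- Let $\mathbb K$ be an algebraically closed field of characteristic zero. **Bidiagonal pairs.** Let $V$ be a $\mathbb K$-vector space of finite positive dimension and let $A, A^*$ be linear maps $V\to V$. The ordered pair $A, A^*$ is a *bidiagonal pair* on $V$ if: (i) $A$ and $A^*$ are diagonalizable; (ii) there are orderings $V_0,\dots,V_d$ of the eigenspaces of $A$ and $V^*_0,\dots,V^*_\delta$ of the eigenspaces of $A^*$ with $A V^*_i\subseteq V^*_i+V^*_{i+1}$ for $0\le i\le\delta$ and $A^*V_i\subseteq V_i+V_{i+1}$ for $0\le i\le d$, where $V_{d+1}=0=V^*_{\delta+1}$; (iii) with $[A,A^*]=AA^*-A^*A$, the restrictions $[A,A^*]^{\delta-2i}:V^*_i\to V^*_{\delta-i}$ for $0\le i\le\delta/2$ and $[A,A^*]^{d-2i}:V_i\to V_{d-i}$ for $0\le i\le d/2$ are bijections. Then $d=\delta$ is the *diameter*, and the eigenvalues $\theta_i$ of $A$ on $V_i$ and $\theta_i^*$ of $A^*$ on $V_i^*$ form the *eigenvalue sequence* and the *dual eigenvalue sequence*. The *fundamental relation with scalar* $b\in\mathbb K\setminus\{0\}$ is $AA^*-bA^*A-\alpha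 A-\alpha^*A^*-\gamma I=0$ for some $\alpha,\alpha^*,\gamma\in\mathbb K$. If $d\ge 2$ the *base* of the pair is the $b$ for which it holds; if $d\le 1$ the base is $1$ by convention. The pair, with base $b$, is *reduced* if either $b=1$, $\theta_i=2i-d$ and $\theta_i^*=d-2i$ for $0\le i\le d$, or $b\ne 1$ and, for some $q$ with $q^2=b^{-1}$, $\theta_i=q^{d-2i}$ and $\theta_i^*=q^{2i-d}$ for $0\le i\le d$. **Theorem.** (1) Let $h=\operatorname{diag}(1,-1)\in\mathfrak{sl}_2=\mathfrak{sl}_2(\mathbb K)$, and let $V$ be an $\mathfrak{sl}_2$-module of finite positive dimension that is *segregated*: $V$ is spanned by vectors $v$ with $h.v=iv$ for an even integer $i$ (depending on $v$), or $V$ is spanned by vectors $v$ with $h.v=iv$ for an odd integer $i$. Let $Y,Z\in\mathfrak{sl}_2$ be an *equitable pair*: there is $X$ such that $X,Y,Z$ is a basis of $\mathfrak{sl}_2$ with $[X,Y]=2X+2Y$, $[Y,Z]=2Y+2Z$, $[Z,X]=2Z+2X$. Then $Y,Z$ acts on $V$ as a reduced bidiagonal pair with base $1$. (2) Let $q\in\mathbb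 K$ be nonzero and not a root of unity. Let $U_q(\mathfrak{sl}_2)$ be the unital associative $\mathbb K$-algebra with generators $k,k^{-1},e,f$ and relations $kk^{-1}=k^{-1}k=1$, $ke=q^2ek$, $kf=q^{-2}fk$, $ef-fe=(k-k^{-1})/(q-q^{-1})$. Let $y,z$ be an *equitable pair*, completed by $x^{\pm1}$: that is, $x,x^{-1},y,z$ generate $U_q(\mathfrak{sl}_2)$ and $$xx^{-1}=x^{-1}x=1,\qquad \frac{qxy-q^{-1}yx}{q-q^{-1}}=\frac{qyz-q^{-1}zy}{q-q^{-1}}=\frac{qzx-q^{-1}xz}{q-q^{-1}}=1.$$ Let $V$ be a $U_q(\mathfrak{sl}_2)$-module of finite positive dimension that is *segregated* with respect to $x$: $V$ is spanned by vectors $v$ with $x.v=q^iv$ for an even integer $i$, or $V$ is spanned by vectors $v$ with $x.v=q^iv$ for an odd integer $i$. Then $y,z$ acts on $V$ as a bidiagonal pair, of some diameter $d$, with eigenvalue sequence $\{q^{d-2i}\}_{i=0}^d$ and dual eigenvalue sequence $\{q^{2i-d}\}_{i=0}^d$, and this pair satisfies the fundamental relation with scalar $q^{-2}\neq1$. If $d\ge2$,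 it is a reduced bidiagonal pair with base $q^{-2}$, which is not equal to $1$. In particular, $x=k$, $y=k^{-1}+(q-q^{-1})f$, $z=k^{-1}-q(q-q^{-1})k^{-1}e$ together with $k^{-1}$ are such generators, and the conclusion of (2) holds for these $y,z$ on every module that is segregated in the usual sense, that is, with respect to $k$. -/

import Mathlib

universe u v

noncomputable section

namespace BidiagPair

/-! ### Bidiagonal pairs -/

section Linear

variable {K : Type u} [Field K] {V : Type v} [AddCommGroup V] [Module K V]

/-- `V` is the sum of the eigenspaces of `A`. -/
def IsDiagonalizable (A : Module.End K V) : Prop :=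
  ⨆ μ : K, A.eigenspace μ = ⊤

/-- `θ 0, …, θ d` lists the eigenvalues of `A`, each exactly once. Equivalently, the eigenspaces
of `A` with eigenvalues `θ 0, …, θ d` form an ordering of the eigenspaces of `A`. -/
def IsEigenOrdering (A : Module.End K V) {d : ℕ} (θ : Fin (d + 1) → K) : Prop :=
  Function.Injective θ ∧ ∀ μ : K, A.HasEigenvalue μ ↔ ∃ i, θ i = μ

/-- The `i`-th eigenspace `V_i` of `A` for the ordering `θ`, with `V_i = 0` for `i > d`. -/
def eigSpace (A : Module.End K V) {d : ℕ} (θ : Fin (d + 1) → K) (i : ℕ) : Submodule K V :=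
  if h : i < d + 1 then A.eigenspace (θ ⟨i, h⟩) else ⊥

/-- The commutator `[A, A'] = A A' - A' A`. -/
def comm (A A' : Module.End K V) : Module.End K V := A * A' - A' * A

/-- `A, A'` is a bidiagonal pair on `V`, of diameter `d`, with eigenvalue sequence `θ` and dual
eigenvalue sequence `θ'`; the eigenspaces of `A` and `A'` so ordered are the standard orderings. -/
structure IsBidiagonalPairWith (A A' : Module.End K V) {d δ : ℕ}
    (θ : Fin (d + 1) → K) (θ' : Fin (δ + 1) → K) : Prop where
  finite : FiniteDimensional K V
  nontrivial : Nontrivial V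
  diag : IsDiagonalizable A
  diag' : IsDiagonalizable A'
  ordering : IsEigenOrdering A θ
  ordering' : IsEigenOrdering A' θ'
  map_le' : ∀ i ≤ δ, (eigSpace A' θ' i).map A ≤ eigSpace A' θ' i ⊔ eigSpace A' θ' (i + 1)
  map_le : ∀ i ≤ d, (eigSpace A θ i).map A' ≤ eigSpace A θ i ⊔ eigSpace A θ (i + 1)
  bij' : ∀ i, 2 * i ≤ δ → Set.BijOn (comm A A' ^ (δ - 2 * i))
    (eigSpace A' θ' i) (eigSpace A' θ' (δ - i))
  bij : ∀ i, 2 * i ≤ d → Set.BijOn (comm A A' ^ (d - 2 * i))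
    (eigSpace A θ i) (eigSpace A θ (d - i))

/-- `A A' - b A' A - α A - α' A' - γ I = 0` for some scalars `α, α', γ`. -/
def FundamentalRelation (A A' : Module.End K V) (b : K) : Prop :=
  ∃ α α' γ : K, A * A' - b • (A' * A) - α • A - α' • A' - γ • (1 : Module.End K V) = 0

/-- `b` is the base of the bidiagonal pair `A, A'` of diameter `d`: the nonzero scalar of the
fundamental relation if `d ≥ 2`, and `1` by convention if `d ≤ 1`. -/
def IsBase (A A' : Module.End K V) (d : ℕ) (b : K) : Prop :=
  b ≠ 0 ∧ FundamentalRelation A A' b ∧ (d ≤ 1 → b = 1)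

/-- `A, A'` is a reduced bidiagonal pair of diameter `d` with base `b`. -/
def IsReducedBidiagonalPair (A A' : Module.End K V) (d : ℕ) (b : K) : Prop :=
  ∃ θ θ' : Fin (d + 1) → K, IsBidiagonalPairWith A A' θ θ' ∧ IsBase A A' d b ∧
    ((b = 1 ∧ (∀ i, θ i = 2 * (i : ℕ) - d) ∧ (∀ i, θ' i = d - 2 * (i : ℕ))) ∨
     (b ≠ 1 ∧ ∃ q : K, q ^ 2 = b⁻¹ ∧
        (∀ i, θ i = q ^ ((d : ℤ) - 2 * (i : ℕ))) ∧ (∀ i, θ' i = q ^ (2 * (i : ℕ) - (d : ℤ)))))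

end Linear

/-! ### The Lie algebra `sl₂` -/

section SL2

variable (K : Type u) [Field K]

/-- The Lie algebra `sl₂` over `K`: traceless `2 × 2` matrices. -/
abbrev SL2 : Type u := LieAlgebra.SpecialLinear.sl (Fin 2) K

/-- `h = diag(1, -1)`. -/
def SL2.h : SL2 K := LieAlgebra.SpecialLinear.singleSubSingle 0 1 1

/-- `e = E₁₂`. -/
def SL2.e : SL2 K := LieAlgebra.SpecialLinear.single 0 1 (by decide) 1

/-- `f = E₂₁`. -/
def SL2.f : SL2 K := LieAlgebra.SpecialLinear.single 1 0 (by decide) 1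

variable {K}

theorem SL2.h_lie_e : ⁅SL2.h K, SL2.e K⁆ = (2 : K) • SL2.e K := by
  apply Subtype.ext
  rw [LieAlgebra.SpecialLinear.sl_bracket]
  ext i j
  fin_cases i <;> fin_cases j <;> simp [SL2.h, SL2.e, Matrix.single, Matrix.mul_apply]; all_goals norm_num

theorem SL2.h_lie_f : ⁅SL2.h K, SL2.f K⁆ = (-2 : K) • SL2.f K := by
  apply Subtype.ext
  rw [LieAlgebra.SpecialLinear.sl_bracket]
  ext i j
  fin_cases i <;> fin_cases j <;> simp [SL2.h, SL2.f, Matrix.single, Matrix.mul_apply]; all_goals norm_num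

theorem SL2.e_lie_f : ⁅SL2.e K, SL2.f K⁆ = SL2.h K := by
  apply Subtype.ext
  rw [LieAlgebra.SpecialLinear.sl_bracket]
  ext i j
  fin_cases i <;> fin_cases j <;> simp [SL2.h, SL2.e, SL2.f, Matrix.single, Matrix.mul_apply]

/-- `X, Y, Z` is an equitable basis of `sl₂`. -/
structure SL2.IsEquitableBasis (X Y Z : SL2 K) : Prop where
  linearIndependent : LinearIndependent K ![X, Y, Z]
  span_eq_top : Submodule.span K {X, Y, Z} = ⊤
  lie_XY : ⁅X, Y⁆ = (2 : K) • X + (2 : K) • Y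
  lie_YZ : ⁅Y, Z⁆ = (2 : K) • Y + (2 : K) • Z
  lie_ZX : ⁅Z, X⁆ = (2 : K) • Z + (2 : K) • X

/-- `Y, Z` is an equitable pair in `sl₂`. -/
def SL2.IsEquitablePair (Y Z : SL2 K) : Prop := ∃ X, SL2.IsEquitableBasis X Y Z

variable (K) (V : Type v) [AddCommGroup V] [Module K V] [LieRingModule (SL2 K) V]

/-- The span of the `v` with `h v = i v` for some even integer `i`. -/
def SL2.evenPart : Submodule K V :=
  Submodule.span K {v | ∃ i : ℤ, Even i ∧ ⁅SL2.h K, v⁆ = (i : K) • v}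

/-- The span of the `v` with `h v = i v` for some odd integer `i`. -/
def SL2.oddPart : Submodule K V :=
  Submodule.span K {v | ∃ i : ℤ, Odd i ∧ ⁅SL2.h K, v⁆ = (i : K) • v}

/-- `V` is a segregated `sl₂`-module. -/
def SL2.IsSegregated : Prop :=
  FiniteDimensional K V ∧ Nontrivial V ∧ (SL2.evenPart K V = ⊤ ∨ SL2.oddPart K V = ⊤)

end SL2

/-! ### The quantum group `U_q(sl₂)` -/

section Uq

/-- Names of the generators of `U_q(sl₂)`. -/
inductive UqGen : Type
  | k | kinv | e | f

variable {K : Type u} [Field K]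

open FreeAlgebra in
/-- The defining relations of `U_q(sl₂)`. -/
inductive UqRel (q : K) : FreeAlgebra K UqGen → FreeAlgebra K UqGen → Prop
  | k_kinv : UqRel q (ι K UqGen.k * ι K UqGen.kinv) 1
  | kinv_k : UqRel q (ι K UqGen.kinv * ι K UqGen.k) 1
  | k_e : UqRel q (ι K UqGen.k * ι K UqGen.e) (q ^ 2 • (ι K UqGen.e * ι K UqGen.k))
  | k_f : UqRel q (ι K UqGen.k * ι K UqGen.f) ((q ^ 2)⁻¹ • (ι K UqGen.f * ι K UqGen.k))
  | e_f : UqRel q (ι K UqGen.e * ι K UqGen.f - ι K UqGen.f * ι K UqGen.e)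
      ((q - q⁻¹)⁻¹ • (ι K UqGen.k - ι K UqGen.kinv))

/-- The algebra `U_q(sl₂)`. -/
abbrev Uq (q : K) : Type u := RingQuot (UqRel q)

/-- The image in `U_q(sl₂)` of a generator. -/
def Uq.gen (q : K) (s : UqGen) : Uq q := RingQuot.mkAlgHom K (UqRel q) (FreeAlgebra.ι K s)

/-- `x, x⁻¹ = xi, y, z` are equitable generators of `U_q(sl₂)`: they generate this algebra and
satisfy the relations of the equitable presentation. -/
structure Uq.IsEquitableGenerators (q : K) (x xi y z : Uq q) : Prop where
  adjoin_eq_top : Algebra.adjoin K {x, xi, y, z} = ⊤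
  x_xi : x * xi = 1
  xi_x : xi * x = 1
  xy : (q - q⁻¹)⁻¹ • (q • (x * y) - q⁻¹ • (y * x)) = 1
  yz : (q - q⁻¹)⁻¹ • (q • (y * z) - q⁻¹ • (z * y)) = 1
  zx : (q - q⁻¹)⁻¹ • (q • (z * x) - q⁻¹ • (x * z)) = 1

/-- The equitable generator `y = k⁻¹ + (q - q⁻¹) f`. -/
def Uq.stdY (q : K) : Uq q := Uq.gen q .kinv + (q - q⁻¹) • Uq.gen q .f

/-- The equitable generator `z = k⁻¹ - q (q - q⁻¹) k⁻¹ e`. -/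
def Uq.stdZ (q : K) : Uq q :=
  Uq.gen q .kinv - (q * (q - q⁻¹)) • (Uq.gen q .kinv * Uq.gen q .e)

variable (q : K) (g : Uq q) (V : Type v) [AddCommGroup V] [Module K V] [Module (Uq q) V]

/-- The span of the `v` with `g v = q ^ i v` for some even integer `i`. -/
def Uq.evenPart : Submodule K V :=
  Submodule.span K {v | ∃ i : ℤ, Even i ∧ g • v = (q ^ i) • v}

/-- The span of the `v` with `g v = q ^ i v` for some odd integer `i`. -/
def Uq.oddPart : Submodule K V :=
  Submodule.span K {v | ∃ i : ℤ, Odd i ∧ g • v = (q ^ i) • v}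

/-- `V` is a `U_q(sl₂)`-module that is segregated with respect to the element `g`, which plays
the role of the generator `k` (equivalently, of the equitable generator `x`). -/
def Uq.IsSegregatedWrt : Prop :=
  FiniteDimensional K V ∧ Nontrivial V ∧ (Uq.evenPart q g V = ⊤ ∨ Uq.oddPart q g V = ⊤)

/-- `V` is a segregated `U_q(sl₂)`-module: it is segregated with respect to `k`. -/
def Uq.IsSegregated : Prop := Uq.IsSegregatedWrt q (Uq.gen q .k) V

variable {q V} in
/-- The pair `y, z` in `U_q(sl₂)` acts on `V` as a bidiagonal pair, of some diameter `d`, with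
eigenvalue sequence `q ^ (d - 2 i)` and dual eigenvalue sequence `q ^ (2 i - d)`; it satisfies the
fundamental relation with `b = q⁻² ≠ 1`; and if `d ≥ 2`, so that `b` is its base,
it is reduced. -/
def Uq.ActsAsReducedPair [IsScalarTower K (Uq q) V] (y z : Uq q) : Prop :=
  ∃ d : ℕ,
    IsBidiagonalPairWith (Algebra.lsmul K K V y) (Algebra.lsmul K K V z)
      (fun i : Fin (d + 1) => q ^ ((d : ℤ) - 2 * (i : ℕ)))
      (fun i : Fin (d + 1) => q ^ (2 * (i : ℕ) - (d : ℤ))) ∧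
    (q ^ 2)⁻¹ ≠ 1 ∧
    FundamentalRelation (Algebra.lsmul K K V y) (Algebra.lsmul K K V z) (q ^ 2)⁻¹ ∧
    (2 ≤ d →
      IsReducedBidiagonalPair (Algebra.lsmul K K V y) (Algebra.lsmul K K V z) d (q ^ 2)⁻¹)

end Uq

end BidiagPair

end

noncomputable section

namespace BidiagPair

/-! ### Diagonalizability of triangular maps, and eigenvalues of one parity -/

section WeightSpaces

variable {K : Type u} [Field K] {V : Type v} [AddCommGroup V] [Module K V]

/-! Both halves are one weight argument. Let `A, A'` be the pair and let `W w` be the eigenspace of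
`A` for the eigenvalue `w` in the Lie case, `q ^ (-w)` in the quantum case. The third equitable
generator supplies operators `n`, `m` shifting the weight by `+2` and `-2`: `n = Y + Z`, `m = X +
Y`, respectively `n = 1 - yz`, `m = 1 - yx`. On `W w` they satisfy `n m = c m n + s(w)`, with `c =
1` or `c = q²`, and the commutator of the pair is a nonzero multiple of `n`. Axiom (iii) is
therefore hard Lefschetz: `n ^ r` is a bijection from `W (-r)` to `W r`. This is proved directly
from the relation (`pow_raise_injective`, `bijOn_pow_raise`), without complete reducibility or a
list of irreducible modules. It also forces the weights to be exactly `-d, 2 - d, …, d`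
(`exists_isBidiagonalHalf`).

Two symmetries remove the remaining work. Reversing the triple, with the sign `p` or with `q`
inverted, exchanges `n` and `m`; rotating and then reversing puts the other member of the pair in
the middle. The two diameters agree because a top weight vector is killed by `n`, which makes it an
eigenvector of the other member with weight `d` (`IsBidiagonalHalf.le_of_top`).

Diagonalizability has to be carried from `h` or `x` to the pair. A map that is triangular on the
eigenspaces of a diagonalizable one, with distinct diagonal scalars, is again diagonalizable with
those scalars. In the quantum case this passes from `x` to `y` to `z`. In the Lie case an equitable
`Y` has determinant `-1` and is reached from `h` by at most two triangular changes, after a change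
of sign in one case (`SL2.hasParitySpectrum_of_h`). -/

/-- An injective family of scalars contains only finitely many eigenvalues. -/
theorem finite_setOf_eigenspace_ne_bot [FiniteDimensional K V] (A : Module.End K V) {θ : ℤ → K}
    (hθ : Function.Injective θ) : {j : ℤ | A.eigenspace (θ j) ≠ ⊥}.Finite := by
  have h : {μ : K | A.HasEigenvalue μ}.Finite := Module.End.finite_hasEigenvalue A
  exact h.preimage hθ.injOn

theorem exists_bound_eigenspace_eq_bot [FiniteDimensional K V] (A : Module.End K V) {θ : ℤ → K}
    (hθ : Function.Injective θ) : ∃ N : ℕ, ∀ j : ℤ, (N : ℤ) ≤ |j| → A.eigenspace (θ j) = ⊥ := by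
  have hf := finite_setOf_eigenspace_ne_bot A hθ
  obtain ⟨N, hN⟩ := (hf.image (fun j : ℤ => j.natAbs)).bddAbove
  refine ⟨N + 1, fun j hj => ?_⟩
  by_contra hne
  have h : j.natAbs ≤ N :=
    hN (Set.mem_image_of_mem _ (show j ∈ {j : ℤ | A.eigenspace (θ j) ≠ ⊥} from hne))
  rw [Int.abs_eq_natAbs] at hj
  omega

/-- A linear map that acts on the eigenspaces of a diagonalizable map in a triangular way, with
distinct scalars on the diagonal, is diagonalizable. -/
theorem iSup_eigenspace_eq_top_of_triangular [FiniteDimensional K V] {A B : Module.End K V}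
    {θ φ : ℤ → K} (hθ : Function.Injective θ) (hφ : Function.Injective φ)
    (hA : ⨆ j, A.eigenspace (θ j) = ⊤)
    (hB : ∀ j, ∀ v ∈ A.eigenspace (θ j), B v - φ j • v ∈ A.eigenspace (θ (j + 1))) :
    ⨆ j, B.eigenspace (φ j) = ⊤ := by
  obtain ⟨N, hN⟩ := exists_bound_eigenspace_eq_bot A hθ
  -- Downward induction on `j`, starting where the eigenspaces vanish; `k` bounds the distance to
  -- `N`.
  have key : ∀ k : ℕ, ∀ j : ℤ, (N : ℤ) ≤ j + k →
      A.eigenspace (θ j) ≤ ⨆ i : ℤ, ⨆ _ : j ≤ i, B.eigenspace (φ i) := by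
    intro k
    induction k with
    | zero =>
      intro j hj
      rw [hN j (le_trans (by simpa using hj) (le_abs_self j))]
      exact bot_le
    | succ k ih =>
      intro j hj v hv
      have hw := ih (j + 1) (by push_cast at hj; omega) (hB j v hv)
      set P : Submodule K V := ⨆ i : ℤ, ⨆ _ : j + 1 ≤ i, B.eigenspace (φ i) with hP
      -- `P` involves only eigenvalues other than `φ j`, so `B - φ j` maps `P` onto itself. Hence
      -- `v` can be corrected by some `w ∈ P` to an eigenvector `v - w`.
      have hle : P ≤ P.map (B - φ j • (1 : Module.End K V)) := by
        refine iSup₂_le fun i hi u hu => ?_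
        have hne : φ i - φ j ≠ 0 := sub_ne_zero.2 fun h => by
          have := hφ h
          omega
        refine ⟨(φ i - φ j)⁻¹ • u, P.smul_mem _ ((le_iSup₂ (f := fun (i : ℤ) (_ : j + 1 ≤ i) =>
          B.eigenspace (φ i)) i hi) hu), ?_⟩
        have hu' := Module.End.mem_eigenspace_iff.1 hu
        simp only [map_smul, LinearMap.sub_apply, LinearMap.smul_apply, Module.End.one_apply, hu']
        rw [← sub_smul, smul_smul, inv_mul_cancel₀ hne, one_smul]
      obtain ⟨w, hwP, hw'⟩ := hle hw
      have hPle : P ≤ ⨆ i : ℤ, ⨆ _ : j ≤ i, B.eigenspace (φ i) :=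
        iSup₂_le fun i hi => le_iSup₂ (f := fun (i : ℤ) (_ : j ≤ i) => B.eigenspace (φ i)) i
          (by omega)
      have hvw : v - w ∈ B.eigenspace (φ j) := by
        rw [Module.End.mem_eigenspace_iff, map_sub, smul_sub]
        simp only [LinearMap.sub_apply, LinearMap.smul_apply, Module.End.one_apply] at hw'
        rw [sub_eq_sub_iff_sub_eq_sub]
        exact hw'.symm
      have := add_mem ((le_iSup₂ (f := fun (i : ℤ) (_ : j ≤ i) => B.eigenspace (φ i)) j le_rfl) hvw)
        (hPle hwP)
      rwa [sub_add_cancel] at this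
  rw [eq_top_iff, ← hA]
  refine iSup_le fun j => (key (N + j.natAbs) j (by push_cast; linarith [neg_abs_le j])).trans ?_
  exact iSup₂_le fun i _ => le_iSup (fun i => B.eigenspace (φ i)) i

/-- `A` is diagonalizable with eigenvalues `θ w`, where the integers `w` have the same parity. -/
def HasParitySpectrum (A : Module.End K V) (θ : ℤ → K) : Prop :=
  ∃ ε : ℤ, ⨆ j : ℤ, A.eigenspace (θ (ε + 2 * j)) = ⊤

theorem HasParitySpectrum.comp_neg {A : Module.End K V} {θ : ℤ → K} (h : HasParitySpectrum A θ) :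
    HasParitySpectrum A (fun w => θ (-w)) := by
  obtain ⟨ε, h⟩ := h
  refine ⟨-ε, ?_⟩
  rw [← h, ← (Equiv.neg ℤ).iSup_comp]
  refine iSup_congr fun j => ?_
  beta_reduce
  rw [Equiv.neg_apply, show -(-ε + 2 * -j) = ε + 2 * j by ring]

theorem HasParitySpectrum.of_span {A : Module.End K V} {θ : ℤ → K}
    (h : Submodule.span K {v | ∃ i : ℤ, Even i ∧ A v = θ i • v} = ⊤ ∨
      Submodule.span K {v | ∃ i : ℤ, Odd i ∧ A v = θ i • v} = ⊤) : HasParitySpectrum A θ := by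
  rcases h with h | h
  · refine ⟨0, ?_⟩
    rw [eq_top_iff, ← h, Submodule.span_le]
    rintro v ⟨i, ⟨j, rfl⟩, hv⟩
    refine le_iSup (fun j : ℤ => A.eigenspace (θ (0 + 2 * j))) j
      (Module.End.mem_eigenspace_iff.2 ?_)
    rw [hv, zero_add, two_mul]
  · refine ⟨1, ?_⟩
    rw [eq_top_iff, ← h, Submodule.span_le]
    rintro v ⟨i, ⟨j, rfl⟩, hv⟩
    refine le_iSup (fun j : ℤ => A.eigenspace (θ (1 + 2 * j))) j
      (Module.End.mem_eigenspace_iff.2 ?_)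
    rw [hv, add_comm]

theorem HasParitySpectrum.triangular [FiniteDimensional K V] {A B : Module.End K V}
    {θ φ : ℤ → K} (hθ : Function.Injective θ) (hφ : Function.Injective φ)
    (hA : HasParitySpectrum A θ)
    (hB : ∀ w, ∀ v ∈ A.eigenspace (θ w), B v - φ w • v ∈ A.eigenspace (θ (w + 2))) :
    HasParitySpectrum B φ := by
  obtain ⟨ε, hA⟩ := hA
  have hinj : Function.Injective fun j : ℤ => ε + 2 * j := fun i j h => by
    simp only at h
    omega
  refine ⟨ε, iSup_eigenspace_eq_top_of_triangular (hθ.comp hinj) (hφ.comp hinj) hA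
    fun j v hv => ?_⟩
  have := hB _ v hv
  rwa [add_assoc, show 2 * j + 2 = 2 * (j + 1) by ring] at this

/-! ### Raising and lowering operators, hard Lefschetz -/

theorem pow_raise_mem {W : ℤ → Submodule K V} {n : Module.End K V}
    (hn : ∀ w, ∀ v ∈ W w, n v ∈ W (w + 2)) {w : ℤ} {v : V} (hv : v ∈ W w) (t : ℕ) :
    (n ^ t) v ∈ W (w + 2 * t) := by
  induction t with
  | zero => simpa using hv
  | succ t ih =>
    rw [pow_succ', Module.End.mul_apply]
    have := hn _ _ ih
    convert this using 2
    push_cast; ring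

/-- Moving `m` leftwards past each factor `n` costs a factor `c` and leaves a scalar term at the
current weight. The accumulated scalar is what decides the Lefschetz property. -/
theorem pow_raise_lower {W : ℤ → Submodule K V} {n m : Module.End K V} {c : K} {s : ℤ → K}
    (hn : ∀ w, ∀ v ∈ W w, n v ∈ W (w + 2))
    (hrel : ∀ w, ∀ v ∈ W w, n (m v) = c • m (n v) + s w • v)
    {w : ℤ} {v : V} (hv : v ∈ W w) (t : ℕ) :
    (n ^ (t + 1)) (m v) = c ^ (t + 1) • m ((n ^ (t + 1)) v) +
      (∑ u ∈ Finset.range (t + 1), c ^ u * s (w + 2 * u)) • (n ^ t) v := by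
  induction t with
  | zero => simpa using hrel w v hv
  | succ t ih =>
    have h := hrel _ _ (pow_raise_mem hn hv (t + 1))
    rw [pow_succ' n (t + 1), Module.End.mul_apply, ih, map_add, map_smul, map_smul, h,
      Finset.sum_range_succ _ (t + 1), ← Module.End.mul_apply n (n ^ t), ← pow_succ',
      ← Module.End.mul_apply n (n ^ (t + 1)), ← pow_succ']
    module

/-- The hard Lefschetz property, injectivity part. -/
theorem pow_raise_injective {W : ℤ → Submodule K V} {n m : Module.End K V} {c : K} {s : ℤ → K}
    (hn : ∀ w, ∀ v ∈ W w, n v ∈ W (w + 2)) (hm : ∀ w, ∀ v ∈ W w, m v ∈ W (w - 2))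
    (hrel : ∀ w, ∀ v ∈ W w, n (m v) = c • m (n v) + s w • v)
    (hzero : ∀ r : ℕ, ∑ u ∈ Finset.range (r + 1), c ^ u * s (-r + 2 * u) = 0)
    (hne : ∀ r t : ℕ, t < r → ∑ u ∈ Finset.range (t + 1), c ^ u * s (-r + 2 * u) ≠ 0)
    (hbd : ∃ N : ℕ, ∀ r : ℕ, N ≤ r → W (-r) = ⊥) (r : ℕ) {v : V} (hv : v ∈ W (-r))
    (hnv : (n ^ r) v = 0) : v = 0 := by
  obtain ⟨N, hN⟩ := hbd
  -- Induction from the lowest weights upwards: the claim for `r + 2`, applied to `m v`, yields the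
  -- claim for `r`.
  have key : ∀ k r : ℕ, N ≤ r + k → ∀ v ∈ W (-r), (n ^ r) v = 0 → v = 0 := by
    intro k
    induction k with
    | zero =>
      intro r hr v hv _
      simpa [hN r (by simpa using hr)] using hv
    | succ k ih =>
      intro r hr v hv hnv
      have hnv' : (n ^ (r + 1)) v = 0 := by rw [pow_succ', Module.End.mul_apply, hnv, map_zero]
      have hmv : m v = 0 := by
        refine ih (r + 2) (by omega) (m v) ?_ ?_
        · have := hm _ _ hv
          convert this using 2
          push_cast; ring
        · rw [show r + 2 = (r + 1) + 1 from rfl, pow_succ', Module.End.mul_apply,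
            pow_raise_lower hn hrel hv r, hnv', hzero r]
          simp
      -- Now `v` is a lowest weight vector, so `pow_raise_lower` reduces to a nonzero scalar times
      -- `n ^ t v` once `n ^ (t + 1) v = 0`. The exponent descends to `0`.
      have hdesc : ∀ t : ℕ, t ≤ r → (n ^ t) v = 0 → v = 0 := by
        intro t
        induction t with
        | zero => intro _ h; simpa using h
        | succ t iht =>
          intro ht h
          refine iht (by omega) ?_
          have h' := pow_raise_lower hn hrel hv t
          rw [hmv, h, map_zero, map_zero, smul_zero, zero_add, eq_comm] at h'
          exact (smul_eq_zero.1 h').resolve_left (hne r t (by omega))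
      exact hdesc r le_rfl hnv
  exact key N r (by omega) v hv hnv

/-! ### One member of a bidiagonal pair -/

/-- The conditions on a bidiagonal pair that concern the eigenspaces of its member `A`; the
eigenvalues are `θ (-d), θ (2 - d), …, θ d`. -/
structure IsBidiagonalHalf (A A' C : Module.End K V) (θ : ℤ → K) (d : ℕ) : Prop where
  support : ∀ w, A.eigenspace (θ w) ≠ ⊥ ↔ ∃ i : ℕ, i ≤ d ∧ w = 2 * i - d
  diag : IsDiagonalizable A
  ordering : IsEigenOrdering A (fun i : Fin (d + 1) => θ (2 * (i : ℕ) - d))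
  map_le : ∀ i ≤ d, (eigSpace A (fun i : Fin (d + 1) => θ (2 * (i : ℕ) - d)) i).map A' ≤
    eigSpace A (fun i : Fin (d + 1) => θ (2 * (i : ℕ) - d)) i ⊔
      eigSpace A (fun i : Fin (d + 1) => θ (2 * (i : ℕ) - d)) (i + 1)
  bij : ∀ i, 2 * i ≤ d → Set.BijOn (C ^ (d - 2 * i))
    (eigSpace A (fun i : Fin (d + 1) => θ (2 * (i : ℕ) - d)) i)
    (eigSpace A (fun i : Fin (d + 1) => θ (2 * (i : ℕ) - d)) (d - i))

/-- The injections `n ^ r` and `m ^ r` in opposite directions force equal dimensions, so each is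
onto; they need not be inverse to one another. -/
theorem bijOn_pow_raise [FiniteDimensional K V] {W : ℤ → Submodule K V} {n m : Module.End K V}
    (hn : ∀ w, ∀ v ∈ W w, n v ∈ W (w + 2)) (hm : ∀ w, ∀ v ∈ W w, m v ∈ W (w - 2))
    (hninj : ∀ (r : ℕ), ∀ v ∈ W (-r), (n ^ r) v = 0 → v = 0)
    (hminj : ∀ (r : ℕ), ∀ v ∈ W r, (m ^ r) v = 0 → v = 0) (r : ℕ) :
    Set.BijOn (n ^ r) (W (-r)) (W r) := by
  have hn' : ∀ v ∈ W (-r), (n ^ r) v ∈ W r := fun v hv => by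
    have := pow_raise_mem hn hv r
    convert this using 2
    ring
  have hm' : ∀ v ∈ W r, (m ^ r) v ∈ W (-r) := fun v hv => by
    have := pow_raise_mem (W := fun w => W (-w)) (n := m) (w := -r) (v := v)
      (fun w v hv => by
        have := hm _ _ hv
        convert this using 2
        ring) (by simpa using hv) r
    convert this using 2
    ring
  have hin : Function.Injective ((n ^ r).restrict hn') := by
    rw [← LinearMap.ker_eq_bot, LinearMap.ker_eq_bot']
    rintro ⟨v, hv⟩ h
    exact Subtype.ext (hninj r v hv (congrArg Subtype.val h))
  have him : Function.Injective ((m ^ r).restrict hm') := by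
    rw [← LinearMap.ker_eq_bot, LinearMap.ker_eq_bot']
    rintro ⟨v, hv⟩ h
    exact Subtype.ext (hminj r v hv (congrArg Subtype.val h))
  have hdim := le_antisymm (LinearMap.finrank_le_finrank_of_injective hin)
    (LinearMap.finrank_le_finrank_of_injective him)
  have hsurj := (LinearMap.injective_iff_surjective_of_finrank_eq_finrank hdim).1 hin
  refine ⟨hn', fun a ha b hb hab => ?_, fun b hb => ?_⟩
  · exact congrArg Subtype.val (hin (a₁ := ⟨a, ha⟩) (a₂ := ⟨b, hb⟩) (Subtype.ext hab))
  · obtain ⟨⟨a, ha⟩, h⟩ := hsurj ⟨b, hb⟩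
    exact ⟨a, ha, congrArg Subtype.val h⟩

theorem exists_eigenspace_neg_eq_bot [FiniteDimensional K V] (A : Module.End K V) {θ : ℤ → K}
    (hθ : Function.Injective θ) : ∃ N : ℕ, ∀ r : ℕ, N ≤ r → A.eigenspace (θ (-r)) = ⊥ := by
  obtain ⟨N, hN⟩ := exists_bound_eigenspace_eq_bot A hθ
  refine ⟨N, fun r hr => hN _ ?_⟩
  rw [abs_neg, Nat.abs_cast]
  exact_mod_cast hr

/-- The diameter is the largest absolute value of a weight. Lefschetz makes the set of weights
symmetric at its extremes and free of gaps. -/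
theorem exists_isBidiagonalHalf [FiniteDimensional K V] [Nontrivial V]
    {A A' C n m : Module.End K V} {θ : ℤ → K} (hθ : Function.Injective θ) (hA : HasParitySpectrum A θ)
    (hn : ∀ w, ∀ v ∈ A.eigenspace (θ w), n v ∈ A.eigenspace (θ (w + 2)))
    (hm : ∀ w, ∀ v ∈ A.eigenspace (θ w), m v ∈ A.eigenspace (θ (w - 2)))
    (hninj : ∀ (r : ℕ), ∀ v ∈ A.eigenspace (θ (-r)), (n ^ r) v = 0 → v = 0)
    (hminj : ∀ (r : ℕ), ∀ v ∈ A.eigenspace (θ r), (m ^ r) v = 0 → v = 0)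
    (hA' : ∀ w, ∀ v ∈ A.eigenspace (θ w),
      A' v ∈ A.eigenspace (θ w) ⊔ A.eigenspace (θ (w + 2)))
    {κ : K} (hκ : κ ≠ 0) (hC : C = κ • n) : ∃ d, IsBidiagonalHalf A A' C θ d := by
  obtain ⟨ε, hA⟩ := hA
  -- Eigenspaces are independent and the listed ones already span, so there is no room for another.
  have hev : ∀ μ, A.eigenspace μ ≠ ⊥ → ∃ j : ℤ, θ (ε + 2 * j) = μ := by
    intro μ hμ
    by_contra! hcon
    refine hμ ?_
    have hind := Module.End.eigenspaces_iSupIndep A μ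
    have htop : ⨆ ν, ⨆ _ : ν ≠ μ, A.eigenspace ν = ⊤ := by
      rw [eq_top_iff, ← hA]
      exact iSup_le fun j => le_iSup₂ (f := fun (ν : K) (_ : ν ≠ μ) => A.eigenspace ν) _ (hcon j)
    rwa [htop, disjoint_top] at hind
  have hpar : ∀ w, A.eigenspace (θ w) ≠ ⊥ → ∃ j : ℤ, w = ε + 2 * j := fun w hw => by
    obtain ⟨j, hj⟩ := hev _ hw
    exact ⟨j, (hθ hj).symm⟩
  have hnonempty : {w : ℤ | A.eigenspace (θ w) ≠ ⊥}.Nonempty := by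
    by_contra hcon
    rw [Set.not_nonempty_iff_eq_empty, Set.eq_empty_iff_forall_notMem] at hcon
    simp only [Set.mem_ofPred_eq, not_not] at hcon
    simp [hcon] at hA
  obtain ⟨w₀, hw₀, hmax⟩ := Set.exists_max_image _ (fun w : ℤ => w.natAbs)
    (finite_setOf_eigenspace_ne_bot A hθ) hnonempty
  simp only [Set.mem_ofPred_eq] at hw₀ hmax
  have hbij := bijOn_pow_raise (W := fun w => A.eigenspace (θ w)) hn hm hninj hminj
  set d := w₀.natAbs with hd
  -- If the extremal weight is `d`, its space is the image of that of `-d` under `n ^ d`.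
  have hlow : A.eigenspace (θ (-d)) ≠ ⊥ := by
    rcases Int.natAbs_eq w₀ with h | h
    · intro hbot
      apply hw₀
      rw [eq_bot_iff]
      intro v hv
      rw [h] at hv
      obtain ⟨u, hu, rfl⟩ := (hbij d).surjOn hv
      simp only [SetLike.mem_coe] at hu
      rw [hbot, Submodule.mem_bot] at hu
      simp [hu]
    · rwa [← h]
  have hsupp : ∀ w, A.eigenspace (θ w) ≠ ⊥ ↔ ∃ i : ℕ, i ≤ d ∧ w = 2 * i - d := by
    intro w
    constructor
    · intro hw
      have h1 := hmax w hw
      obtain ⟨j, hj⟩ := hpar w hw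
      obtain ⟨j', hj'⟩ := hpar _ hlow
      refine ⟨(j - j').toNat, by omega, by omega⟩
    · rintro ⟨i, hi, rfl⟩ hbot
      -- Since `n ^ d` does not kill `v`, no `n ^ i v` with `i ≤ d` vanishes: every intermediate
      -- weight occurs.
      obtain ⟨v, hv, hv0⟩ := Submodule.exists_mem_ne_zero_of_ne_bot hlow
      refine hv0 (hninj d v hv ?_)
      have h := pow_raise_mem (W := fun w => A.eigenspace (θ w)) hn hv i
      simp only [show -(d : ℤ) + 2 * i = 2 * i - d by ring] at h
      rw [hbot, Submodule.mem_bot] at h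
      rw [show d = (d - i) + i by omega, pow_add, Module.End.mul_apply, h, map_zero]
  -- Past `d` the default `⊥` agrees with the true eigenspace, so the boundary case `V_{d+1} = 0`
  -- needs no separate treatment.
  have hspace : ∀ i : ℕ, eigSpace A (fun i : Fin (d + 1) => θ (2 * (i : ℕ) - d)) i =
      A.eigenspace (θ (2 * i - d)) := by
    intro i
    unfold eigSpace
    split_ifs with h
    · rfl
    · by_contra hne
      obtain ⟨i', hi', h'⟩ := (hsupp _).1 (Ne.symm hne)
      omega
  refine ⟨d, hsupp, ?_, ⟨fun i j hij => ?_, fun μ => ⟨fun hμ => ?_, ?_⟩⟩, fun i hi => ?_,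
    fun i hi => ?_⟩
  · rw [IsDiagonalizable, eq_top_iff, ← hA]
    exact iSup_le fun j => le_iSup A.eigenspace _
  · have := hθ hij
    ext
    omega
  · obtain ⟨j, rfl⟩ := hev μ hμ
    obtain ⟨i, hi, h⟩ := (hsupp _).1 hμ
    exact ⟨⟨i, by omega⟩, by simp [h]⟩
  · rintro ⟨i, rfl⟩
    exact (hsupp _).2 ⟨i, by omega, rfl⟩
  · rw [hspace, hspace]
    rintro _ ⟨v, hv, rfl⟩
    have := hA' _ _ hv
    rwa [show (2 * (i : ℤ) - d + 2) = 2 * ((i + 1 : ℕ) : ℤ) - d by push_cast; ring] at this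
  · rw [hspace, hspace]
    have h := hbij (d - 2 * i)
    rw [show -((d - 2 * i : ℕ) : ℤ) = 2 * i - d by omega,
      show ((d - 2 * i : ℕ) : ℤ) = 2 * (d - i : ℕ) - d by omega] at h
    set k := d - 2 * i
    have hκ' : κ ^ k ≠ 0 := pow_ne_zero _ hκ
    rw [hC, smul_pow]
    refine ⟨fun v hv => ?_, fun a ha b hb hab => h.injOn ha hb ?_, fun b hb => ?_⟩
    · exact Submodule.smul_mem _ _ (h.mapsTo hv)
    · exact smul_right_injective V hκ' hab
    · obtain ⟨a, ha, hab⟩ := h.surjOn (Submodule.smul_mem _ (κ ^ k)⁻¹ hb)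
      exact ⟨a, ha, by rw [LinearMap.smul_apply, hab, smul_smul, mul_inv_cancel₀ hκ', one_smul]⟩

theorem IsBidiagonalHalf.isBidiagonalPairWith [FiniteDimensional K V] [Nontrivial V]
    {A A' : Module.End K V} {θ θ' : ℤ → K} {d : ℕ} (h : IsBidiagonalHalf A A' (comm A A') θ d)
    (h' : IsBidiagonalHalf A' A (comm A A') θ' d) :
    IsBidiagonalPairWith A A' (fun i : Fin (d + 1) => θ (2 * (i : ℕ) - d))
      (fun i : Fin (d + 1) => θ' (2 * (i : ℕ) - d)) :=
  ⟨inferInstance, inferInstance, h.diag, h'.diag, h.ordering, h'.ordering, h'.map_le, h.map_le,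
    h'.bij, h.bij⟩

/-- Used in both directions to equate the diameters of the two halves: a nonzero space of `B`-weight
`d` puts `d` among the weights `-d', …, d'`. -/
theorem IsBidiagonalHalf.le_of_top {A A' B B' C C' : Module.End K V} {θ φ : ℤ → K} {d d' : ℕ}
    (h : IsBidiagonalHalf A A' C θ d) (h' : IsBidiagonalHalf B B' C' φ d')
    (htop : A.eigenspace (θ (d + 2)) = ⊥ → A.eigenspace (θ d) ≤ B.eigenspace (φ d)) :
    d ≤ d' := by
  have h1 : A.eigenspace (θ (d + 2)) = ⊥ := by
    by_contra hne
    obtain ⟨i, hi, h⟩ := (h.support _).1 hne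
    omega
  have h2 := (h.support d).2 ⟨d, le_rfl, by ring⟩
  obtain ⟨i, hi, hi'⟩ := (h'.support d).1 fun hbot => h2 (le_bot_iff.1 (hbot ▸ htop h1))
  omega

end WeightSpaces
end BidiagPair
end

noncomputable section

namespace BidiagPair

/-! ### Equitable triples acting on modules over the Lie algebra -/

section SL2Action

variable {K : Type u} [Field K] {V : Type v} [AddCommGroup V] [Module K V]

/-- The action of an equitable basis of `sl₂`, with a scalar `p` (a sign) such that reversing the
order of the basis replaces `p` by `-p`. -/
structure SL2.IsEquitableTriple (p : K) (X Y Z : Module.End K V) : Prop where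
  XY : ∀ v, X (Y v) - Y (X v) = p • ((2 : K) • X v + (2 : K) • Y v)
  YZ : ∀ v, Y (Z v) - Z (Y v) = p • ((2 : K) • Y v + (2 : K) • Z v)
  ZX : ∀ v, Z (X v) - X (Z v) = p • ((2 : K) • Z v + (2 : K) • X v)

theorem SL2.IsEquitableTriple.reverse {p : K} {X Y Z : Module.End K V}
    (h : SL2.IsEquitableTriple p X Y Z) : SL2.IsEquitableTriple (-p) Z Y X where
  XY v := by linear_combination (norm := module) (-1 : K) • h.YZ v
  YZ v := by linear_combination (norm := module) (-1 : K) • h.XY v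
  ZX v := by linear_combination (norm := module) (-1 : K) • h.ZX v

theorem SL2.IsEquitableTriple.rotate {p : K} {X Y Z : Module.End K V}
    (h : SL2.IsEquitableTriple p X Y Z) : SL2.IsEquitableTriple p Y Z X := ⟨h.YZ, h.ZX, h.XY⟩

namespace SL2.IsEquitableTriple

variable {p : K} {X Y Z : Module.End K V}

/-- The relation for `Y, Z` says `[Y, Y + Z] = 2p(Y + Z)`. -/
theorem raise (h : IsEquitableTriple p X Y Z) {w : ℤ} {v : V} (hv : v ∈ Y.eigenspace (p * w)) :
    (Y + Z) v ∈ Y.eigenspace (p * (w + 2 : ℤ)) := by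
  rw [Module.End.mem_eigenspace_iff] at hv ⊢
  have h1 := h.YZ v
  simp only [LinearMap.add_apply, map_add, map_smul, hv] at h1 ⊢
  push_cast
  linear_combination (norm := module) h1

theorem lower (h : IsEquitableTriple p X Y Z) {w : ℤ} {v : V} (hv : v ∈ Y.eigenspace (p * w)) :
    (X + Y) v ∈ Y.eigenspace (p * (w - 2 : ℤ)) := by
  rw [Module.End.mem_eigenspace_iff] at hv ⊢
  have h1 := h.XY v
  simp only [LinearMap.add_apply, map_add, map_smul, hv] at h1 ⊢
  push_cast
  linear_combination (norm := module) -h1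

theorem raise_lower (h : IsEquitableTriple p X Y Z) (hp : p * p = 1) {w : ℤ} {v : V}
    (hv : v ∈ Y.eigenspace (p * w)) :
    (Y + Z) ((X + Y) v) = (1 : K) • (X + Y) ((Y + Z) v) + (-4 * (w : K)) • v := by
  rw [Module.End.mem_eigenspace_iff] at hv
  have h1 := h.XY v
  have h2 := h.YZ v
  have h3 := h.ZX v
  have h4 : (-4 * (w : K)) • v = (-4 * (p * p) * (w : K)) • v := by rw [hp, mul_one]
  rw [h4]
  simp only [LinearMap.add_apply, map_add, map_smul, hv] at h1 h2 h3 ⊢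
  linear_combination (norm := module) h3 - h1 - h2

/-- The Lefschetz scalar in closed form: it vanishes at `t = r + 1` and, in characteristic zero, not
for `1 ≤ t ≤ r`. -/
theorem sum_weight (r t : ℕ) : ∑ u ∈ Finset.range t,
    (1 : K) ^ u * (-4 * ((-r + 2 * u : ℤ) : K)) = 4 * (t * (r + 1 - t)) := by
  induction t with
  | zero => simp
  | succ t ih =>
    rw [Finset.sum_range_succ, ih]
    push_cast
    ring

theorem mul_intCast_injective [CharZero K] (hp : p * p = 1) :
    Function.Injective fun w : ℤ => p * (w : K) := by
  have hp0 : p ≠ 0 := by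
    rintro rfl
    simp at hp
  exact (mul_right_injective₀ hp0).comp Int.cast_injective

theorem raise_injective [CharZero K] [FiniteDimensional K V] (h : IsEquitableTriple p X Y Z)
    (hp : p * p = 1) (r : ℕ) {v : V} (hv : v ∈ Y.eigenspace (p * (-r : ℤ)))
    (hnv : ((Y + Z) ^ r) v = 0) : v = 0 := by
  refine pow_raise_injective (W := fun w : ℤ => Y.eigenspace (p * (w : K)))
    (n := Y + Z) (m := X + Y) (c := 1)
    (s := fun w => -4 * (w : K)) (fun w v hv => h.raise hv) (fun w v hv => h.lower hv)
    (fun w v hv => h.raise_lower hp hv) (fun r => ?_) (fun r t ht => ?_)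
    (exists_eigenspace_neg_eq_bot Y (θ := fun w : ℤ => p * (w : K)) (mul_intCast_injective hp)) r hv hnv
  · refine (sum_weight r (r + 1)).trans ?_
    push_cast
    ring
  · refine ne_of_eq_of_ne (sum_weight r (t + 1)) ?_
    have : ((r : K) + 1 - (t + 1 : ℕ)) = ((r - t : ℕ) : K) := by
      rw [Nat.cast_sub ht.le]
      push_cast
      ring
    rw [this]
    have h1 : ((t + 1 : ℕ) : K) ≠ 0 := Nat.cast_ne_zero.2 (by omega)
    have h2 : ((r - t : ℕ) : K) ≠ 0 := Nat.cast_ne_zero.2 (by omega)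
    exact mul_ne_zero (OfNat.ofNat_ne_zero 4) (mul_ne_zero h1 h2)

theorem exists_half [CharZero K] [FiniteDimensional K V] [Nontrivial V]
    (h : IsEquitableTriple p X Y Z) (hp : p * p = 1)
    (hY : HasParitySpectrum Y fun w => p * (w : K)) {C : Module.End K V} {κ : K} (hκ : κ ≠ 0)
    (hC : C = κ • (Y + Z)) : ∃ d, IsBidiagonalHalf Y Z C (fun w => p * (w : K)) d := by
  refine exists_isBidiagonalHalf (n := Y + Z) (m := X + Y) (mul_intCast_injective hp) hY
    (fun w v hv => h.raise hv) (fun w v hv => h.lower hv)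
    (fun r v hv hnv => h.raise_injective hp r hv hnv) (fun r v hv hmv => ?_) (fun w v hv => ?_)
    hκ hC
  -- In the reversed triple the raising operator is `Y + X`, and weight `r` for `p` is weight `-r`
  -- for `-p`.
  · refine h.reverse.raise_injective (by rw [neg_mul_neg, hp]) r (v := v) ?_ ?_
    · convert hv using 2
      push_cast
      ring
    · rwa [add_comm Y X]
  · have h1 := Module.End.mem_eigenspace_iff.1 hv
    have h2 : Z v = -((p * (w : K)) • v) + (Y + Z) v := by
      rw [LinearMap.add_apply, h1]
      abel
    rw [h2]
    exact Submodule.add_mem_sup (neg_mem (Submodule.smul_mem _ _ hv)) (h.raise hv)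

theorem triangular [CharZero K] [FiniteDimensional K V] (h : IsEquitableTriple p X Y Z)
    (hp : p * p = 1) (hY : HasParitySpectrum Y fun w => p * (w : K)) :
    HasParitySpectrum Z fun w => -p * (w : K) := by
  refine hY.triangular (mul_intCast_injective hp)
    (mul_intCast_injective (by rw [neg_mul_neg, hp])) fun w v hv => ?_
  have h1 := Module.End.mem_eigenspace_iff.1 hv
  have h2 : Z v - (-p * (w : K)) • v = (Y + Z) v := by
    rw [LinearMap.add_apply, h1]
    module
  rw [h2]
  exact h.raise hv

theorem isReducedBidiagonalPair [CharZero K] [FiniteDimensional K V] [Nontrivial V]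
    (h : IsEquitableTriple 1 X Y Z) (hY : HasParitySpectrum Y fun w => (w : K)) :
    ∃ d, IsReducedBidiagonalPair Y Z d 1 := by
  have hY' : HasParitySpectrum Y fun w => (1 : K) * (w : K) := by simpa using hY
  have hcomm : comm Y Z = (2 : K) • (Y + Z) := LinearMap.ext fun v => by
    have := h.YZ v
    simp only [comm, LinearMap.sub_apply, Module.End.mul_apply, LinearMap.smul_apply,
      LinearMap.add_apply]
    linear_combination (norm := module) this
  -- With `Z` in the middle the sign is `-1`, which turns the weights `2i - d` into the dual
  -- eigenvalues `d - 2i`.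
  have h' : IsEquitableTriple (-1) X Z Y := h.rotate.reverse
  obtain ⟨d, hd⟩ := h.exists_half (one_mul 1) hY' two_ne_zero hcomm
  obtain ⟨d', hd'⟩ := h'.exists_half (by ring) (h.triangular (one_mul 1) hY') two_ne_zero
    (hcomm.trans (by rw [add_comm]))
  have hdd : d = d' := by
    refine le_antisymm (hd.le_of_top hd' fun hbot v hv => ?_) (hd'.le_of_top hd fun hbot v hv => ?_)
    · have h1 := h.raise hv
      rw [hbot, Submodule.mem_bot] at h1
      rw [Module.End.mem_eigenspace_iff] at hv ⊢
      rw [LinearMap.add_apply, hv] at h1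
      linear_combination (norm := module) h1
    · have h1 := h'.raise hv
      rw [hbot, Submodule.mem_bot] at h1
      rw [Module.End.mem_eigenspace_iff] at hv ⊢
      rw [LinearMap.add_apply, hv] at h1
      linear_combination (norm := module) h1
  subst hdd
  refine ⟨d, _, _, hd.isBidiagonalPairWith hd', ⟨one_ne_zero, ⟨2, 2, 0, ?_⟩, fun _ => rfl⟩,
    Or.inl ⟨rfl, fun i => ?_, fun i => ?_⟩⟩
  · have : Y * Z - (1 : K) • (Z * Y) = (2 : K) • (Y + Z) := by rw [one_smul, ← hcomm, comm]
    rw [this]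
    module
  · push_cast
    ring
  · push_cast
    ring

end SL2.IsEquitableTriple

theorem HasParitySpectrum.neg {A : Module.End K V} (h : HasParitySpectrum A fun w => (w : K)) :
    HasParitySpectrum (-A) fun w => (w : K) := by
  obtain ⟨ε, h⟩ := h.comp_neg
  refine ⟨ε, ?_⟩
  rw [← h]
  refine iSup_congr fun j => Submodule.ext fun v => ?_
  rw [Module.End.mem_eigenspace_iff, Module.End.mem_eigenspace_iff, LinearMap.neg_apply,
    neg_eq_iff_eq_neg]
  push_cast
  rw [neg_smul]

/-! ### From `h` to an element of an equitable pair -/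

variable [LieRingModule (SL2 K) V] [LieModule K (SL2 K) V]

/-- `N` shifts the weights of `H` by `±2`, so `H + N` is triangular with the same diagonal; the
lowering case uses negated weights. -/
theorem HasParitySpectrum.add_of_lie [CharZero K] [FiniteDimensional K V] {H N : SL2 K}
    (h : HasParitySpectrum (LieModule.toEnd K (SL2 K) V H) fun w => (w : K))
    (hN : ⁅H, N⁆ = (2 : K) • N ∨ ⁅H, N⁆ = (-2 : K) • N) :
    HasParitySpectrum (LieModule.toEnd K (SL2 K) V (H + N)) fun w => (w : K) := by
  have hneg : Function.Injective fun w : ℤ => ((-w : ℤ) : K) :=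
    Int.cast_injective.comp neg_injective
  rcases hN with hN | hN
  · refine h.triangular Int.cast_injective Int.cast_injective fun w v hv => ?_
    rw [Module.End.mem_eigenspace_iff, LieModule.toEnd_apply_apply] at *
    have h1 : ⁅H, ⁅N, v⁆⁆ = ((w : K) + 2) • ⁅N, v⁆ := by
      rw [leibniz_lie, hN, hv, smul_lie, lie_smul]
      module
    rw [LieModule.toEnd_apply_apply, add_lie, hv, add_sub_cancel_left]
    push_cast
    exact h1
  · have h' := h.comp_neg.triangular (B := LieModule.toEnd K (SL2 K) V (H + N)) hneg hneg
      fun w v hv => by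
      rw [Module.End.mem_eigenspace_iff, LieModule.toEnd_apply_apply] at *
      have h1 : ⁅H, ⁅N, v⁆⁆ = (((-w : ℤ) : K) - 2) • ⁅N, v⁆ := by
        rw [leibniz_lie, hN, hv, smul_lie, lie_smul]
        module
      rw [LieModule.toEnd_apply_apply, add_lie, hv, add_sub_cancel_left, h1]
      push_cast
      module
    simpa using h'.comp_neg

theorem SL2.matrix_one_one (Y : SL2 K) : Y.1 1 1 = -Y.1 0 0 := by
  have h : Matrix.trace Y.1 = 0 := Y.2
  rw [Matrix.trace_fin_two] at h
  exact eq_neg_of_add_eq_zero_right h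

theorem SL2.lie_eq_smul_iff {H N : SL2 K} {r : K} :
    ⁅H, N⁆ = r • N ↔ H.1 * N.1 - N.1 * H.1 = r • N.1 := by
  rw [Subtype.ext_iff, LieAlgebra.SpecialLinear.sl_bracket]
  rfl

/-- The determinant of a member of an equitable basis is `-1`. -/
theorem SL2.IsEquitableBasis.sq_add_mul [CharZero K] {X Y Z : SL2 K}
    (h : SL2.IsEquitableBasis X Y Z) : Y.1 0 0 ^ 2 + Y.1 0 1 * Y.1 1 0 = 1 := by
  have hN : Y + Z ≠ 0 := fun h0 => by
    have := Fintype.linearIndependent_iff.1 h.linearIndependent ![0, 1, 1]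
      (by simpa [Fin.sum_univ_three] using h0) 1
    simp at this
  have hN' : (Y + Z).1 ≠ 0 := fun h0 => hN (Subtype.ext h0)
  have hlie : ⁅Y, Y + Z⁆ = (2 : K) • (Y + Z) := by
    rw [lie_add, lie_self, zero_add, h.lie_YZ, smul_add]
  rw [SL2.lie_eq_smul_iff] at hlie
  set n := (Y + Z).1
  set y := Y.1 with hy
  set δ := y 0 0 ^ 2 + y 0 1 * y 1 0 with hδ
  -- Cayley–Hamilton for trace zero. As `y²` is central, `yn - ny = 2n` forces `yn + ny = 0`, so `yn
  -- = n` and `δ n = y² n = n` with `n ≠ 0`.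
  have hyy : y * y = δ • (1 : Matrix (Fin 2) (Fin 2) K) := by
    have := SL2.matrix_one_one Y
    rw [← hy] at this
    ext i j
    fin_cases i <;> fin_cases j <;> simp [Matrix.mul_apply, this, hδ] <;> ring
  have hanti : (2 : K) • (y * n + n * y) = 0 := by
    calc (2 : K) • (y * n + n * y) = y * ((2 : K) • n) + ((2 : K) • n) * y := by
          rw [smul_add, mul_smul_comm, smul_mul_assoc]
      _ = (y * y) * n - n * (y * y) := by
          rw [← hlie]
          noncomm_ring
      _ = 0 := by rw [hyy]; simp
  have hanti' := (smul_eq_zero.1 hanti).resolve_left two_ne_zero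
  have hyn : y * n = n := by
    have : (2 : K) • (y * n) = (2 : K) • n := by
      rw [← hlie, eq_neg_of_add_eq_zero_right hanti']
      module
    exact smul_right_injective _ (two_ne_zero (α := K)) this
  have hδn : (δ - 1) • n = 0 := by
    have : δ • n = n := by
      calc δ • n = (y * y) * n := by rw [hyy, smul_mul_assoc, one_mul]
        _ = n := by rw [mul_assoc, hyn, hyn]
    rw [sub_smul, this, one_smul, sub_self]
  exact sub_eq_zero.1 ((smul_eq_zero.1 hδn).resolve_right hN')

/-- `Y` is conjugate to `h`, but instead of lifting the conjugation to `V` the spectrum is carried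
along triangular changes. If `Y` is upper triangular it is `±h` plus a multiple of `e`; otherwise an
intermediate `h + t e` is used. -/
theorem SL2.hasParitySpectrum_of_h [CharZero K] [FiniteDimensional K V]
    (hh : HasParitySpectrum (LieModule.toEnd K (SL2 K) V (SL2.h K)) fun w => (w : K)) {Y : SL2 K}
    (hY : Y.1 0 0 ^ 2 + Y.1 0 1 * Y.1 1 0 = 1) :
    HasParitySpectrum (LieModule.toEnd K (SL2 K) V Y) fun w => (w : K) := by
  have h11 := SL2.matrix_one_one Y
  by_cases hc : Y.1 1 0 = 0
  · have ha : Y.1 0 0 = 1 ∨ Y.1 0 0 = -1 := by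
      rw [hc, mul_zero, add_zero] at hY
      exact sq_eq_one_iff.1 hY
    rcases ha with ha | ha
    · have hYe : Y = SL2.h K + Y.1 0 1 • SL2.e K := by
        apply Subtype.ext
        ext i j
        fin_cases i <;> fin_cases j <;> simp [SL2.h, SL2.e, Matrix.single, ha, hc, h11]
      rw [hYe]
      refine hh.add_of_lie (Or.inl ?_)
      rw [lie_smul, SL2.h_lie_e, smul_comm]
    · have hYe : Y = -SL2.h K + Y.1 0 1 • SL2.e K := by
        apply Subtype.ext
        ext i j
        fin_cases i <;> fin_cases j <;> simp [SL2.h, SL2.e, Matrix.single, ha, hc, h11]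
      rw [hYe]
      refine HasParitySpectrum.add_of_lie (by rw [map_neg]; exact hh.neg) (Or.inr ?_)
      rw [lie_smul, neg_lie, SL2.h_lie_e, smul_neg, smul_comm, neg_smul]
  -- This `t` makes `h + t e` and `Y` share their `(-1)`-eigenline, spanned by `(t, -2)`. Their
  -- difference `N` is then nilpotent with `[h + t e, N] = -2N`.
  · obtain ⟨t, ht'⟩ : ∃ t, t * Y.1 1 0 = 2 - 2 * Y.1 0 0 := ⟨_, div_mul_cancel₀ _ hc⟩
    have ht'' : t * (1 + Y.1 0 0) = 2 * Y.1 0 1 := by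
      apply mul_right_cancel₀ hc
      linear_combination (1 + Y.1 0 0) * ht' - 2 * hY
    have h1 : HasParitySpectrum (LieModule.toEnd K (SL2 K) V (SL2.h K + t • SL2.e K))
        fun w => (w : K) := by
      refine hh.add_of_lie (Or.inl ?_)
      rw [lie_smul, SL2.h_lie_e, smul_comm]
    have h2 := h1.add_of_lie (N := Y - (SL2.h K + t • SL2.e K)) (Or.inr ?_)
    · rwa [add_sub_cancel] at h2
    · rw [SL2.lie_eq_smul_iff]
      ext i j
      fin_cases i <;> fin_cases j <;>
        simp [SL2.h, SL2.e, Matrix.single, Matrix.mul_apply, h11]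
      · linear_combination ht'
      · linear_combination -2 * ht''
      · ring
      · linear_combination ht'

theorem SL2.IsEquitableBasis.isEquitableTriple {X Y Z : SL2 K}
    (h : SL2.IsEquitableBasis X Y Z) : SL2.IsEquitableTriple 1 (LieModule.toEnd K (SL2 K) V X)
      (LieModule.toEnd K (SL2 K) V Y) (LieModule.toEnd K (SL2 K) V Z) where
  XY v := by
    simp only [LieModule.toEnd_apply_apply]
    rw [← lie_lie, h.lie_XY, add_lie, smul_lie, smul_lie, one_smul]
  YZ v := by
    simp only [LieModule.toEnd_apply_apply]
    rw [← lie_lie, h.lie_YZ, add_lie, smul_lie, smul_lie, one_smul]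
  ZX v := by
    simp only [LieModule.toEnd_apply_apply]
    rw [← lie_lie, h.lie_ZX, add_lie, smul_lie, smul_lie, one_smul]

theorem SL2.IsSegregated.isReducedBidiagonalPair [CharZero K] (hV : SL2.IsSegregated K V)
    {Y Z : SL2 K} (h : SL2.IsEquitablePair Y Z) :
    ∃ d : ℕ, IsReducedBidiagonalPair (LieModule.toEnd K (SL2 K) V Y)
      (LieModule.toEnd K (SL2 K) V Z) d 1 := by
  obtain ⟨X, hX⟩ := h
  obtain ⟨_, _, hspan⟩ := hV
  have hh : HasParitySpectrum (LieModule.toEnd K (SL2 K) V (SL2.h K)) fun w => (w : K) :=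
    .of_span hspan
  exact hX.isEquitableTriple.isReducedBidiagonalPair
    (SL2.hasParitySpectrum_of_h hh hX.sq_add_mul)

end SL2Action
end BidiagPair
end

noncomputable section

namespace BidiagPair

/-! ### Equitable triples acting on modules over the quantum group -/

section UqAction

variable {K : Type u} [Field K] {V : Type v} [AddCommGroup V] [Module K V]

/-- The action of equitable generators of `U_q(sl₂)`. -/
structure Uq.IsEquitableTriple (q : K) (x y z : Module.End K V) : Prop where
  xy : ∀ v, q • x (y v) - q⁻¹ • y (x v) = (q - q⁻¹) • v
  yz : ∀ v, q • y (z v) - q⁻¹ • z (y v) = (q - q⁻¹) • v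
  zx : ∀ v, q • z (x v) - q⁻¹ • x (z v) = (q - q⁻¹) • v

theorem Uq.IsEquitableTriple.reverse {q : K} {x y z : Module.End K V}
    (h : Uq.IsEquitableTriple q x y z) : Uq.IsEquitableTriple q⁻¹ z y x where
  xy v := by rw [inv_inv]; linear_combination (norm := module) (-1 : K) • h.yz v
  yz v := by rw [inv_inv]; linear_combination (norm := module) (-1 : K) • h.xy v
  zx v := by rw [inv_inv]; linear_combination (norm := module) (-1 : K) • h.zx v

theorem Uq.IsEquitableTriple.rotate {q : K} {x y z : Module.End K V}
    (h : Uq.IsEquitableTriple q x y z) : Uq.IsEquitableTriple q y z x := ⟨h.yz, h.zx, h.xy⟩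

theorem zpow_injective_of_forall_pow_ne_one {q : K} (hq : q ≠ 0)
    (hroot : ∀ n : ℕ, 0 < n → q ^ n ≠ 1) : Function.Injective fun w : ℤ => q ^ w := by
  have key : ∀ a b : ℤ, a < b → q ^ a ≠ q ^ b := fun a b hab h => by
    refine hroot (b - a).toNat (by omega) ?_
    rw [← zpow_natCast, Int.toNat_of_nonneg (by omega), zpow_sub₀ hq, h,
      div_self (zpow_ne_zero _ hq)]
  intro a b h
  rcases lt_trichotomy a b with hab | hab | hab
  · exact absurd h (key a b hab)
  · exact hab
  · exact absurd h.symm (key b a hab)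

namespace Uq.IsEquitableTriple

variable {q : K} {x y z : Module.End K V}

theorem inv_pow_ne_one (hroot : ∀ n : ℕ, 0 < n → q ^ n ≠ 1) (n : ℕ) (hn : 0 < n) :
    q⁻¹ ^ n ≠ 1 := by
  rw [inv_pow]
  exact inv_ne_one.2 (hroot n hn)

theorem zpow_neg_injective (hq : q ≠ 0) (hroot : ∀ n : ℕ, 0 < n → q ^ n ≠ 1) :
    Function.Injective fun w : ℤ => q ^ (-w) :=
  (zpow_injective_of_forall_pow_ne_one hq hroot).comp neg_injective

theorem raise (h : IsEquitableTriple q x y z) (hq : q ≠ 0) {w : ℤ} {v : V}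
    (hv : v ∈ y.eigenspace (q ^ (-w))) :
    (1 - y * z) v ∈ y.eigenspace (q ^ (-(w + 2))) := by
  rw [Module.End.mem_eigenspace_iff] at hv ⊢
  have h1 := congrArg y (h.yz v)
  rw [show -(w + 2) = -w - 2 by ring, zpow_sub₀ hq]
  set l := q ^ (-w)
  simp only [LinearMap.sub_apply, Module.End.mul_apply, Module.End.one_apply, map_sub, map_smul,
    hv] at h1 ⊢
  linear_combination (norm := skip) (-q⁻¹) • h1
  match_scalars <;> field_simp <;> ring

theorem lower (h : IsEquitableTriple q x y z) (hq : q ≠ 0) {w : ℤ} {v : V}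
    (hv : v ∈ y.eigenspace (q ^ (-w))) :
    (1 - y * x) v ∈ y.eigenspace (q ^ (-(w - 2))) := by
  rw [Module.End.mem_eigenspace_iff] at hv ⊢
  have h1 := congrArg y (h.xy v)
  rw [show -(w - 2) = -w + 2 by ring, zpow_add₀ hq]
  set l := q ^ (-w)
  simp only [LinearMap.sub_apply, Module.End.mul_apply, Module.End.one_apply, map_sub, map_smul,
    hv] at h1 ⊢
  linear_combination (norm := skip) q • h1
  match_scalars <;> field_simp <;> ring

theorem raise_lower (h : IsEquitableTriple q x y z) (hq : q ≠ 0) {w : ℤ} {v : V}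
    (hv : v ∈ y.eigenspace (q ^ (-w))) :
    (1 - y * z) ((1 - y * x) v) = (q ^ 2) • (1 - y * x) ((1 - y * z) v) +
      ((q ^ 2 - 1) * ((q ^ (-w)) ^ 2 - 1)) • v := by
  rw [Module.End.mem_eigenspace_iff] at hv
  have h1 := congrArg y (h.yz (x v))
  have h2 := congrArg y (h.xy (z v))
  have h3 := congrArg y (congrArg y (h.zx v))
  set l := q ^ (-w)
  simp only [LinearMap.sub_apply, Module.End.mul_apply, Module.End.one_apply, map_sub, map_smul,
    hv] at h1 h2 h3 ⊢
  linear_combination (norm := skip) (-q) • h1 - q • h2 + q • h3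
  match_scalars <;> field_simp <;> ring

/-- The `q`-analogue of `4t(r + 1 - t)`: zero at `t = r + 1`, and nonzero for `1 ≤ t ≤ r` when `q`
is not a root of unity. -/
theorem sum_weight (hq : q ≠ 0) (r t : ℕ) : ∑ u ∈ Finset.range t,
    (q ^ 2) ^ u * ((q ^ 2 - 1) * ((q ^ (-(-r + 2 * u : ℤ))) ^ 2 - 1)) =
      ((q ^ r * q / q ^ t) ^ 2 - 1) * ((q ^ t) ^ 2 - 1) := by
  induction t with
  | zero => simp
  | succ t ih =>
    rw [Finset.sum_range_succ, ih, show -(-r + 2 * t : ℤ) = r - (t + t : ℕ) by push_cast; ring,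
      zpow_sub₀ hq, zpow_natCast, zpow_natCast, pow_right_comm q 2 t, pow_add,
      pow_succ]
    have hQ : q ^ t ≠ 0 := pow_ne_zero _ hq
    set Q := q ^ t
    set R := q ^ r
    field_simp
    ring

theorem raise_injective [FiniteDimensional K V] (h : IsEquitableTriple q x y z)
    (hq : q ≠ 0) (hroot : ∀ n : ℕ, 0 < n → q ^ n ≠ 1) (r : ℕ) {v : V}
    (hv : v ∈ y.eigenspace (q ^ (-(-r) : ℤ))) (hnv : ((1 - y * z) ^ r) v = 0) : v = 0 := by
  refine pow_raise_injective (W := fun w : ℤ => y.eigenspace (q ^ (-w))) (n := 1 - y * z)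
    (m := 1 - y * x) (c := q ^ 2) (s := fun w : ℤ => (q ^ 2 - 1) * ((q ^ (-w)) ^ 2 - 1))
    (fun w v hv => h.raise hq hv) (fun w v hv => h.lower hq hv)
    (fun w v hv => h.raise_lower hq hv) (fun r => ?_) (fun r t ht => ?_)
    (exists_eigenspace_neg_eq_bot y (θ := fun w : ℤ => q ^ (-w)) (zpow_neg_injective hq hroot))
    r hv hnv
  · refine (sum_weight hq r (r + 1)).trans ?_
    rw [← pow_succ, div_self (pow_ne_zero _ hq)]
    ring
  · refine ne_of_eq_of_ne (sum_weight hq r (t + 1)) (mul_ne_zero ?_ ?_)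
    · rw [← pow_succ, show r + 1 = (r - t) + (t + 1) by omega, pow_add _ (r - t),
        mul_div_cancel_right₀ _ (pow_ne_zero _ hq), ← pow_mul, sub_ne_zero]
      exact hroot _ (by omega)
    · rw [← pow_mul, sub_ne_zero]
      exact hroot _ (by omega)

theorem exists_half [FiniteDimensional K V] [Nontrivial V] (h : IsEquitableTriple q x y z)
    (hq : q ≠ 0) (hroot : ∀ n : ℕ, 0 < n → q ^ n ≠ 1)
    (hy : HasParitySpectrum y fun w => q ^ (-w)) {C : Module.End K V} {κ : K} (hκ : κ ≠ 0)
    (hC : C = κ • (1 - y * z)) : ∃ d, IsBidiagonalHalf y z C (fun w => q ^ (-w)) d := by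
  refine exists_isBidiagonalHalf (n := 1 - y * z) (m := 1 - y * x) (zpow_neg_injective hq hroot) hy
    (fun w v hv => h.raise hq hv) (fun w v hv => h.lower hq hv)
    (fun r v hv hnv => h.raise_injective hq hroot r hv hnv) (fun r v hv hmv => ?_)
    (fun w v hv => ?_) hκ hC
  · refine h.reverse.raise_injective (inv_ne_zero hq) (inv_pow_ne_one hroot) r (v := v) ?_ hmv
    rwa [inv_zpow', neg_neg]
  · have h1 := Module.End.mem_eigenspace_iff.1 hv
    have hw : q ^ (-w) ≠ 0 := zpow_ne_zero _ hq
    have h3 := h.yz v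
    -- The `yz` relation solved for `z v`, using that `y` acts on `v` by the invertible scalar `q ^
    -- (-w)`.
    have h2 : z v = (q ^ (-w))⁻¹ • v + (-(q ^ 2 * (q ^ (-w))⁻¹)) • (1 - y * z) v := by
      set l := q ^ (-w)
      simp only [LinearMap.sub_apply, Module.End.mul_apply, Module.End.one_apply, map_smul,
        h1] at h3 ⊢
      linear_combination (norm := skip) (-(q * l⁻¹)) • h3
      match_scalars <;> field_simp <;> ring
    rw [h2]
    exact Submodule.add_mem_sup (Submodule.smul_mem _ _ hv)
      (Submodule.smul_mem _ _ (h.raise hq hv))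

theorem triangular [FiniteDimensional K V] (h : IsEquitableTriple q x y z)
    (hq : q ≠ 0) (hroot : ∀ n : ℕ, 0 < n → q ^ n ≠ 1)
    (hy : HasParitySpectrum y fun w => q ^ (-w)) : HasParitySpectrum z fun w => q ^ w := by
  refine hy.triangular (zpow_neg_injective hq hroot)
    (zpow_injective_of_forall_pow_ne_one hq hroot) fun w v hv => ?_
  have h1 := Module.End.mem_eigenspace_iff.1 hv
  have hw : q ^ w ≠ 0 := zpow_ne_zero _ hq
  have h3 := h.yz v
  have h2 : z v - q ^ w • v = (-(q ^ 2 * q ^ w)) • (1 - y * z) v := by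
    rw [zpow_neg] at h1
    set l := q ^ w
    simp only [LinearMap.sub_apply, Module.End.mul_apply, Module.End.one_apply, map_smul,
      h1] at h3 ⊢
    linear_combination (norm := skip) (-(q * l)) • h3
    match_scalars <;> field_simp <;> ring
  rw [h2]
  exact Submodule.smul_mem _ _ (h.raise hq hv)

/-- With nothing above weight `d`, `y z v = v`, and the `yz` relation then makes `z` act on `v` as
the inverse of the `y`-eigenvalue. -/
theorem apply_top (h : IsEquitableTriple q x y z) (hq : q ≠ 0) {d : ℕ}
    (hbot : y.eigenspace (q ^ (-(d + 2 : ℤ))) = ⊥) :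
    y.eigenspace (q ^ (-(d : ℤ))) ≤ z.eigenspace (q ^ (d : ℤ)) := by
  intro v hv
  have h1 := h.raise hq hv
  rw [hbot, Submodule.mem_bot] at h1
  have h2 := h.yz v
  have hl : q ^ d ≠ 0 := pow_ne_zero _ hq
  rw [Module.End.mem_eigenspace_iff] at hv ⊢
  rw [zpow_neg, zpow_natCast] at hv
  rw [zpow_natCast]
  set l := q ^ d
  simp only [LinearMap.sub_apply, Module.End.mul_apply, Module.End.one_apply, map_smul,
    hv] at h1 h2 ⊢
  linear_combination (norm := skip) (-(q * l)) • h2 - (q ^ 2 * l) • h1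
  match_scalars <;> field_simp <;> ring

theorem exists_pair [FiniteDimensional K V] [Nontrivial V] (h : IsEquitableTriple q x y z)
    (hq : q ≠ 0) (hroot : ∀ n : ℕ, 0 < n → q ^ n ≠ 1)
    (hx : HasParitySpectrum x fun w => q ^ w) :
    ∃ d : ℕ, IsBidiagonalPairWith y z (fun i : Fin (d + 1) => q ^ ((d : ℤ) - 2 * (i : ℕ)))
      (fun i : Fin (d + 1) => q ^ (2 * (i : ℕ) - (d : ℤ))) := by
  have hq2 : q ^ 2 - 1 ≠ 0 := sub_ne_zero.2 (hroot 2 two_pos)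
  have hx' : HasParitySpectrum x fun w => q ^ (-w) := hx.comp_neg
  -- Two rotations give `(z, x, y)`, in which `y` is triangular over the eigenspaces of `x`.
  have hy : HasParitySpectrum y fun w => q ^ w := h.rotate.rotate.triangular hq hroot hx'
  have hy' : HasParitySpectrum y fun w => q ^ (-w) := hy.comp_neg
  have hz : HasParitySpectrum z fun w => q ^ w := h.triangular hq hroot hy'
  have h' : IsEquitableTriple q⁻¹ x z y := h.rotate.reverse
  have hinv : (fun w : ℤ => q⁻¹ ^ (-w)) = fun w : ℤ => q ^ w := by
    funext w
    rw [inv_zpow', neg_neg]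
  have hcomm : comm y z = (q ^ 2 - 1) • (1 - y * z) := LinearMap.ext fun v => by
    have h2 := h.yz v
    simp only [comm, LinearMap.sub_apply, Module.End.mul_apply, LinearMap.smul_apply,
      Module.End.one_apply]
    linear_combination (norm := skip) q • h2
    match_scalars <;> field_simp <;> ring
  have hcomm' : comm y z = (1 - q⁻¹ ^ 2) • (1 - z * y) := LinearMap.ext fun v => by
    have h2 := h.yz v
    simp only [comm, LinearMap.sub_apply, Module.End.mul_apply, LinearMap.smul_apply,
      Module.End.one_apply]
    linear_combination (norm := skip) q⁻¹ • h2
    match_scalars <;> field_simp <;> ring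
  obtain ⟨d, hd⟩ := h.exists_half hq hroot hy' hq2 hcomm
  obtain ⟨d', hd'⟩ := h'.exists_half (inv_ne_zero hq) (inv_pow_ne_one hroot) (by rwa [hinv])
    (sub_ne_zero.2 (inv_pow_ne_one hroot 2 two_pos).symm) hcomm'
  rw [hinv] at hd'
  have hdd : d = d' := by
    refine le_antisymm (hd.le_of_top hd' (h.apply_top hq)) (hd'.le_of_top hd fun hbot => ?_)
    have := h'.apply_top (inv_ne_zero hq) (d := d')
    simp only [inv_zpow', neg_neg] at this
    exact this hbot
  subst hdd
  refine ⟨d, ?_⟩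
  have := hd.isBidiagonalPairWith hd'
  simpa only [neg_sub] using this

end Uq.IsEquitableTriple

theorem Uq.IsEquitableGenerators.actsAsReducedPair {q : K} (hq : q ≠ 0)
    (hroot : ∀ n : ℕ, 0 < n → q ^ n ≠ 1) [Module (Uq q) V] [IsScalarTower K (Uq q) V]
    {x xi y z : Uq q} (h : Uq.IsEquitableGenerators q x xi y z) (hV : Uq.IsSegregatedWrt q x V) :
    Uq.ActsAsReducedPair (V := V) y z := by
  obtain ⟨_, _, hspan⟩ := hV
  have hq2 : q ^ 2 ≠ 1 := hroot 2 two_pos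
  have hqq : q - q⁻¹ ≠ 0 := fun h0 => hq2 (by
    have : q = q⁻¹ := sub_eq_zero.1 h0
    rw [sq]
    nth_rewrite 2 [this]
    exact mul_inv_cancel₀ hq)
  have key : ∀ a b : Uq q, (q - q⁻¹)⁻¹ • (q • (a * b) - q⁻¹ • (b * a)) = 1 → ∀ v : V,
      q • (Algebra.lsmul K K V a) ((Algebra.lsmul K K V b) v) -
        q⁻¹ • (Algebra.lsmul K K V b) ((Algebra.lsmul K K V a) v) = (q - q⁻¹) • v := by
    intro a b hab v
    have h1 := congrArg (fun g => (q - q⁻¹) • (Algebra.lsmul K K V g) v) hab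
    simpa only [map_smul, map_sub, map_mul, map_one, LinearMap.smul_apply, LinearMap.sub_apply,
      Module.End.mul_apply, Module.End.one_apply, smul_smul, mul_inv_cancel₀ hqq,
      one_smul] using h1
  have htriple : Uq.IsEquitableTriple q (Algebra.lsmul K K V x) (Algebra.lsmul K K V y)
      (Algebra.lsmul K K V z) := ⟨key x y h.xy, key y z h.yz, key z x h.zx⟩
  have hx : HasParitySpectrum (Algebra.lsmul K K V x) fun w => q ^ w := .of_span hspan
  obtain ⟨d, hd⟩ := htriple.exists_pair hq hroot hx
  have hb : (q ^ 2)⁻¹ ≠ 1 := inv_ne_one.2 hq2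
  have hfund : FundamentalRelation (Algebra.lsmul K K V y) (Algebra.lsmul K K V z) (q ^ 2)⁻¹ := by
    -- The `yz` relation divided by `q`: `yz - q⁻² zy = 1 - q⁻²`, with no linear terms.
    refine ⟨0, 0, 1 - (q ^ 2)⁻¹, LinearMap.ext fun v => ?_⟩
    have h1 := htriple.yz v
    simp only [LinearMap.sub_apply, Module.End.mul_apply, LinearMap.smul_apply,
      Module.End.one_apply, LinearMap.zero_apply]
    linear_combination (norm := skip) q⁻¹ • h1
    match_scalars <;> field_simp <;> ring
  refine ⟨d, hd, hb, hfund, fun h2 => ⟨_, _, hd, ⟨inv_ne_zero (pow_ne_zero _ hq), hfund,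
    fun h1 => by omega⟩, Or.inr ⟨hb, q, (inv_inv _).symm, fun _ => rfl, fun _ => rfl⟩⟩⟩

end UqAction

/-! ### The standard equitable generators -/

section StandardGenerators

variable {K : Type u} [Field K] (q : K)

theorem Uq.adjoin_range_gen : Algebra.adjoin K (Set.range (Uq.gen q)) = ⊤ := by
  have h : Set.range (Uq.gen q) =
      RingQuot.mkAlgHom K (UqRel q) '' Set.range (FreeAlgebra.ι K) := by
    rw [← Set.range_comp]
    rfl
  rw [h, ← AlgHom.map_adjoin, FreeAlgebra.adjoin_range_ι, Algebra.map_top, AlgHom.range_eq_top]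
  exact RingQuot.mkAlgHom_surjective K _

theorem Uq.k_mul_kinv : Uq.gen q .k * Uq.gen q .kinv = 1 := by
  simpa [Uq.gen] using RingQuot.mkAlgHom_rel K (UqRel.k_kinv (q := q))

theorem Uq.kinv_mul_k : Uq.gen q .kinv * Uq.gen q .k = 1 := by
  simpa [Uq.gen] using RingQuot.mkAlgHom_rel K (UqRel.kinv_k (q := q))

theorem Uq.k_mul_e : Uq.gen q .k * Uq.gen q .e = q ^ 2 • (Uq.gen q .e * Uq.gen q .k) := by
  simpa [Uq.gen] using RingQuot.mkAlgHom_rel K (UqRel.k_e (q := q))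

theorem Uq.k_mul_f : Uq.gen q .k * Uq.gen q .f = (q ^ 2)⁻¹ • (Uq.gen q .f * Uq.gen q .k) := by
  simpa [Uq.gen] using RingQuot.mkAlgHom_rel K (UqRel.k_f (q := q))

theorem Uq.e_mul_f_sub : Uq.gen q .e * Uq.gen q .f - Uq.gen q .f * Uq.gen q .e =
    (q - q⁻¹)⁻¹ • (Uq.gen q .k - Uq.gen q .kinv) := by
  simpa [Uq.gen] using RingQuot.mkAlgHom_rel K (UqRel.e_f (q := q))

variable {q}

theorem Uq.e_mul_kinv : Uq.gen q .e * Uq.gen q .kinv =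
    q ^ 2 • (Uq.gen q .kinv * Uq.gen q .e) := by
  have h := congrArg (fun g => Uq.gen q .kinv * g * Uq.gen q .kinv) (Uq.k_mul_e q)
  simpa only [← mul_assoc, Uq.kinv_mul_k, one_mul, mul_smul_comm, smul_mul_assoc,
    mul_assoc _ (Uq.gen q .k) (Uq.gen q .kinv), Uq.k_mul_kinv, mul_one] using h

theorem Uq.e_mul_k (hq : q ≠ 0) : Uq.gen q .e * Uq.gen q .k =
    (q ^ 2)⁻¹ • (Uq.gen q .k * Uq.gen q .e) := by
  rw [Uq.k_mul_e, smul_smul, inv_mul_cancel₀ (pow_ne_zero _ hq), one_smul]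

theorem Uq.f_mul_k (hq : q ≠ 0) : Uq.gen q .f * Uq.gen q .k =
    q ^ 2 • (Uq.gen q .k * Uq.gen q .f) := by
  rw [Uq.k_mul_f, smul_smul, mul_inv_cancel₀ (pow_ne_zero _ hq), one_smul]

theorem Uq.f_mul_kinv : Uq.gen q .f * Uq.gen q .kinv =
    (q ^ 2)⁻¹ • (Uq.gen q .kinv * Uq.gen q .f) := by
  have h := congrArg (fun g => Uq.gen q .kinv * g * Uq.gen q .kinv) (Uq.k_mul_f q)
  simpa only [← mul_assoc, Uq.kinv_mul_k, one_mul, mul_smul_comm, smul_mul_assoc,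
    mul_assoc _ (Uq.gen q .k) (Uq.gen q .kinv), Uq.k_mul_kinv, mul_one] using h

theorem Uq.isEquitableGenerators_std (hq : q ≠ 0) (hq2 : q ^ 2 ≠ 1) :
    Uq.IsEquitableGenerators q (Uq.gen q .k) (Uq.gen q .kinv) (Uq.stdY q) (Uq.stdZ q) := by
  have hqq : q - q⁻¹ ≠ 0 := fun h0 => hq2 (by
    have : q = q⁻¹ := sub_eq_zero.1 h0
    rw [sq]
    nth_rewrite 2 [this]
    exact mul_inv_cancel₀ hq)
  have hef : Uq.gen q .e * Uq.gen q .f = Uq.gen q .f * Uq.gen q .e +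
      (q - q⁻¹)⁻¹ • (Uq.gen q .k - Uq.gen q .kinv) := by
    rw [← Uq.e_mul_f_sub]
    abel
  have hkk := Uq.k_mul_kinv q
  have hkk' := Uq.kinv_mul_k q
  have hek := Uq.e_mul_k hq
  have hek' := Uq.e_mul_kinv (q := q)
  have hfk := Uq.f_mul_k hq
  have hfk' := Uq.f_mul_kinv (q := q)
  refine ⟨?_, hkk, hkk', ?_, ?_, ?_⟩
  · rw [eq_top_iff, ← Uq.adjoin_range_gen q]
    refine Algebra.adjoin_le ?_
    set S := Algebra.adjoin K
      {Uq.gen q .k, Uq.gen q .kinv, Uq.stdY q, Uq.stdZ q} with hS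
    have hk : Uq.gen q .k ∈ S := Algebra.subset_adjoin (by simp)
    have hkinv : Uq.gen q .kinv ∈ S := Algebra.subset_adjoin (by simp)
    have hy : Uq.stdY q ∈ S := Algebra.subset_adjoin (by simp)
    have hz : Uq.stdZ q ∈ S := Algebra.subset_adjoin (by simp)
    rintro _ ⟨s, rfl⟩
    cases s
    · exact hk
    · exact hkinv
    · have : Uq.gen q .e = (q * (q - q⁻¹))⁻¹ •
          (Uq.gen q .k * (Uq.gen q .kinv - Uq.stdZ q)) := by
        rw [Uq.stdZ, sub_sub_cancel, mul_smul_comm, smul_smul,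
          inv_mul_cancel₀ (mul_ne_zero hq hqq), one_smul, ← mul_assoc, hkk, one_mul]
      rw [this]
      exact S.smul_mem (S.mul_mem hk (S.sub_mem hkinv hz)) _
    · have : Uq.gen q .f = (q - q⁻¹)⁻¹ • (Uq.stdY q - Uq.gen q .kinv) := by
        rw [Uq.stdY, add_sub_cancel_left, smul_smul, inv_mul_cancel₀ hqq, one_smul]
      rw [this]
      exact S.smul_mem (S.sub_mem hy hkinv) _
  -- The three relations are checked by moving `k` and `k⁻¹` to the left and `f` before `e`, then
  -- comparing coefficients of ordered monomials.
  all_goals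
    rw [inv_smul_eq_iff₀ hqq]
    simp only [Uq.stdY, Uq.stdZ]
    generalize Uq.gen q .k = k at *
    generalize Uq.gen q .kinv = k' at *
    generalize Uq.gen q .e = e at *
    generalize Uq.gen q .f = f at *
  · simp only [mul_add, add_mul, mul_smul_comm, smul_mul_assoc, hkk, hkk', hfk]
    match_scalars <;> field_simp <;> ring
  · have h1 : f * (k' * e) = (q ^ 2)⁻¹ • (k' * (f * e)) := by
      rw [← mul_assoc, hfk', smul_mul_assoc, mul_assoc]
    have h2 : k' * e * k' = q ^ 2 • (k' * (k' * e)) := by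
      rw [mul_assoc, hek', mul_smul_comm]
    have h3 : k' * e * f = k' * (f * e) + (q - q⁻¹)⁻¹ • (1 - k' * k') := by
      rw [mul_assoc, hef, mul_add, mul_smul_comm, mul_sub, hkk']
    simp only [mul_add, add_mul, mul_sub, sub_mul, mul_smul_comm, smul_mul_assoc, h1, h2, h3, hfk']
    match_scalars <;> field_simp <;> ring
  · have h1 : k' * e * k = (q ^ 2)⁻¹ • e := by
      rw [mul_assoc, hek, mul_smul_comm, ← mul_assoc, hkk', one_mul]
    have h2 : k * (k' * e) = e := by rw [← mul_assoc, hkk, one_mul]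
    simp only [mul_sub, sub_mul, mul_smul_comm, smul_mul_assoc, hkk, hkk', h1, h2]
    match_scalars <;> field_simp <;> ring

end StandardGenerators

end BidiagPair
end

theorem theorem5p8 {K : Type u} [Field K] [IsAlgClosed K] [CharZero K] :
    -- segregated modules over the Lie algebra
    (∀ (V : Type v) [AddCommGroup V] [Module K V] [LieRingModule (BidiagPair.SL2 K) V]
        [LieModule K (BidiagPair.SL2 K) V] (Y Z : BidiagPair.SL2 K),
      BidiagPair.SL2.IsSegregated K V → BidiagPair.SL2.IsEquitablePair Y Z →
      ∃ d : ℕ, BidiagPair.IsReducedBidiagonalPair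
        (LieModule.toEnd K (BidiagPair.SL2 K) V Y) (LieModule.toEnd K (BidiagPair.SL2 K) V Z)
        d 1) ∧
    -- segregated modules over the quantum group
    (∀ q : K, q ≠ 0 → (∀ n : ℕ, 0 < n → q ^ n ≠ 1) →
      ∀ (V : Type v) [AddCommGroup V] [Module K V] [Module (BidiagPair.Uq q) V]
        [IsScalarTower K (BidiagPair.Uq q) V],
      -- any equitable pair, completed by `x`, the role of `k` being played by `x`
      (∀ x xi y z : BidiagPair.Uq q, BidiagPair.Uq.IsEquitableGenerators q x xi y z →
        BidiagPair.Uq.IsSegregatedWrt q x V →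
        BidiagPair.Uq.ActsAsReducedPair (V := V) y z) ∧
      -- in particular, the standard equitable generators, with `x = k`
      (BidiagPair.Uq.IsSegregated q V →
        BidiagPair.Uq.IsEquitableGenerators q (BidiagPair.Uq.gen q .k)
          (BidiagPair.Uq.gen q .kinv) (BidiagPair.Uq.stdY q) (BidiagPair.Uq.stdZ q) ∧
        BidiagPair.Uq.ActsAsReducedPair (V := V)
          (BidiagPair.Uq.stdY q) (BidiagPair.Uq.stdZ q))) := by
  refine ⟨fun V _ _ _ _ Y Z hV h => hV.isReducedBidiagonalPair h,
    fun q hq hroot V _ _ _ _ => ⟨fun x xi y z h hV => h.actsAsReducedPair hq hroot hV, fun hV => ?_⟩⟩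
  have hstd := BidiagPair.Uq.isEquitableGenerators_std hq (hroot 2 two_pos)
  exact ⟨hstd, hstd.actsAsReducedPair hq hroot hV⟩
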